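/- Let $\mathbf S^1=\mathbb R/\mathbb Z$, let $g_1,\dots,g_k$ be orientation preserving homeomorphisms of $\mathbf S^1$, let $\Gamma=\{g_1,\dots,g_k\}$, and let $p=(p_1,\dots,p_k)$ be a probability vector with all $p_i>0$. For a finite Borel measure $\mu$ on $\mathbf S^1$ put $P\mu=\sum_{i=1}^k p_i\,\mu\circ g_i^{-1}$, and for a continuous $f:\mathbf S^1\to\mathbb R$ put $P^*f(x)=\sum_{i=1}^k p_i f(g_i(x))$. For $\alpha\in\mathbb R$ let $T_\alpha(x)=x+\alpha \pmod 1$ denote the rotation by $\alpha$. Assume that $\Gamma$ contains two rotations $T_\alpha$ and $T_\beta$ with $\alpha,\beta\in\mathbb R$ and $\alpha-\beta$ irrational. Then: (1) for every continuous $f:\mathbf S^1\to\mathbb R$ with $f\ge 0$ and $f\not\equiv 0$ there exists an integer $r\ge 1$ such that $P^{*r}f(x)>0$ for all $x\in\mathbf S^1$; (2) the iterated function system $(\Gamma,p)$ is asymptotically stable: there is a Borel probability measure $\mu_*$ on $\mathbf S^1$ with $P\mu_*=\mu_*$, it is the only invariant Borel probability measure, and for every Borel probability measure $\nu$ and every continuous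 $f:\mathbf S^1\to\mathbb R$, $$\lim_{n\to\infty}\int_{\mathbf S^1} f\,d(P^n\nu)=\int_{\mathbf S^1} f\,d\mu_*.$$ -/

import Mathlib

open MeasureTheory Filter Topology
open scoped NNReal

noncomputable section

/-- A homeomorphism of the circle `ℝ / ℤ` (of length `1`) preserves orientation if it has a
continuous strictly increasing lift `F : ℝ → ℝ` with `F (x + 1) = F x + 1`. -/
def IsOrientationPreserving (g : UnitAddCircle ≃ₜ UnitAddCircle) : Prop :=
  ∃ F : ℝ → ℝ, Continuous F ∧ StrictMono F ∧ (∀ x, F (x + 1) = F x + 1) ∧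
    ∀ x : ℝ, g (x : UnitAddCircle) = (F x : UnitAddCircle)

/-- The rotation `T_α : x ↦ x + α` of the circle `ℝ / ℤ`. -/
def circleRotation (α : ℝ) : UnitAddCircle ≃ₜ UnitAddCircle :=
  Homeomorph.addRight (α : UnitAddCircle)

/-- The Markov operator `P μ = ∑ i, p i • (μ ∘ g i ⁻¹)` on finite Borel measures. -/
def markovOperator {k : ℕ} (g : Fin k → (UnitAddCircle ≃ₜ UnitAddCircle)) (p : Fin k → ℝ≥0)
    (μ : FiniteMeasure UnitAddCircle) : FiniteMeasure UnitAddCircle :=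
  ∑ i, p i • μ.map (g i)

/-- The dual operator `P* f (x) = ∑ i, p i * f (g i x)` on continuous functions. -/
def dualOperator {k : ℕ} (g : Fin k → (UnitAddCircle ≃ₜ UnitAddCircle)) (p : Fin k → ℝ≥0)
    (f : C(UnitAddCircle, ℝ)) : C(UnitAddCircle, ℝ) where
  toFun x := ∑ i, (p i : ℝ) * f (g i x)
  continuous_toFun := by fun_prop

/-- An operator `P` on finite Borel measures on the circle is asymptotically stable if it has a
unique invariant probability measure `μs` and, for every probability measure `ν`, the iterates
`P^n ν` converge to `μs` when integrated against continuous functions. -/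
def IsAsymptoticallyStable
    (P : FiniteMeasure UnitAddCircle → FiniteMeasure UnitAddCircle) : Prop :=
  ∃ μs : ProbabilityMeasure UnitAddCircle,
    P μs.toFiniteMeasure = μs.toFiniteMeasure ∧
    (∀ ν : ProbabilityMeasure UnitAddCircle,
      P ν.toFiniteMeasure = ν.toFiniteMeasure → ν = μs) ∧
    ∀ (f : C(UnitAddCircle, ℝ)) (ν : ProbabilityMeasure UnitAddCircle),
      Tendsto (fun n : ℕ => ∫ x, f x ∂(P^[n] ν.toFiniteMeasure : Measure UnitAddCircle)) atTop
        (𝓝 (∫ x, f x ∂(μs : Measure UnitAddCircle)))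

end

/-!
Let `P*` be the dual operator of the system. Since `P*^r` contains all the rotations by
`m α + (r - m) β`, which become dense in the circle, `P*` is eventually positive; this is (1).

For (2), let `μ` be an invariant probability measure of the *inverse* system `(g i)⁻¹`, which exists
by the Krylov–Bogoliubov argument. Then `μ A = ∑ i, p i * μ (g i '' A)`. The measure `μ` has full
support because the dual operator of the inverse system is also eventually positive. It has no
atoms: the finite set of its heaviest atoms would be mapped into itself by both rotations, so that
`α` and `β` would be rational. Now a bound `|f x - f y| ≤ ε + C * μ A` over all connected `A`
containing `x` and `y` is inherited by `P* f` with the same constants. As `μ` has full support,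
every continuous `f` satisfies such a bound for each `ε > 0`, and as `μ` has no atoms, these bounds
make the sequence `P*^n f` equicontinuous.

By Arzelà–Ascoli a subsequence converges to some `h`. The maximum of `P*^n f` decreases to a limit,
which is therefore the maximum of every `P*^r h`, and eventual positivity forces `h` to be constant.
Since `P*` is a contraction, the whole sequence converges uniformly to this constant, which is
asymptotic stability.
-/

section PositiveOperators

variable {X : Type*} [TopologicalSpace X]

/-- An operator on continuous functions is eventually positive if every nonzero nonnegative
function has a strictly positive iterate; the exponent may depend on the function. -/
def IsEventuallyPositive (T : C(X, ℝ) → C(X, ℝ)) : Prop :=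
  ∀ f, 0 ≤ f → f ≠ 0 → ∃ r : ℕ, 1 ≤ r ∧ ∀ x, 0 < (T^[r] f) x

/-- A measure is invariant under the measure-side dual of an operator `T` on continuous functions.
The duality is expressed through integrals, so `T` need not come from a kernel. -/
def IsInvariantMeasure [MeasurableSpace X] (T : C(X, ℝ) → C(X, ℝ)) (μ : Measure X) : Prop :=
  ∀ f : C(X, ℝ), ∫ x, T f x ∂μ = ∫ x, f x ∂μ

variable {T : C(X, ℝ) →ₚ[ℝ] C(X, ℝ)}

lemma map_const_of_map_one (hT : T 1 = 1) (c : ℝ) :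
    T (ContinuousMap.const X c) = ContinuousMap.const X c := by
  have hc : ContinuousMap.const X c = c • 1 := by ext; simp
  rw [hc, map_smul, hT]

lemma map_le_of_forall_le (hT : T 1 = 1) {f : C(X, ℝ)} {c : ℝ} (hf : ∀ x, f x ≤ c) (x : X) :
    T f x ≤ c := by
  have h : T f ≤ T (ContinuousMap.const X c) := OrderHomClass.mono T hf
  rw [map_const_of_map_one hT] at h
  exact h x

variable [CompactSpace X]

lemma norm_map_le_of_map_one (hT : T 1 = 1) (f : C(X, ℝ)) : ‖T f‖ ≤ ‖f‖ := by
  refine (ContinuousMap.norm_le _ (norm_nonneg f)).2 fun x => abs_le'.2 ⟨?_, ?_⟩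
  · exact map_le_of_forall_le hT (fun y => (le_abs_self _).trans (f.norm_coe_le_norm y)) x
  · have := map_le_of_forall_le (f := -f) hT
      (fun y => (neg_le_abs _).trans (f.norm_coe_le_norm y)) x
    rwa [map_neg] at this

lemma continuous_of_map_one (hT : T 1 = 1) : Continuous T :=
  AddMonoidHomClass.continuous_of_bound T 1 fun f => by
    simpa using norm_map_le_of_map_one hT f

lemma norm_iterate_le_of_map_one (hT : T 1 = 1) (f : C(X, ℝ)) (n : ℕ) : ‖T^[n] f‖ ≤ ‖f‖ := by
  induction n with
  | zero => rfl
  | succ n ih =>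
    rw [Function.iterate_succ_apply']
    exact (norm_map_le_of_map_one hT _).trans ih

lemma le_iSup_continuousMap (f : C(X, ℝ)) (x : X) : f x ≤ ⨆ y, f y :=
  le_ciSup (isCompact_range f.continuous).bddAbove x

lemma continuous_iSup_continuousMap : Continuous fun f : C(X, ℝ) => ⨆ x, f x := by
  have h := isCompact_univ.continuous_sSup (f := fun (f : C(X, ℝ)) (x : X) => f x)
    continuous_eval
  simpa only [Set.image_univ, sSup_range] using h

lemma iSup_map_le_of_map_one [Nonempty X] (hT : T 1 = 1) (f : C(X, ℝ)) :
    ⨆ x, T f x ≤ ⨆ x, f x :=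
  ciSup_le (map_le_of_forall_le hT (le_iSup_continuousMap f))

lemma exists_tendsto_iSup_iterate [Nonempty X] (hT : T 1 = 1) (f : C(X, ℝ)) :
    ∃ M, Tendsto (fun n => ⨆ x, (T^[n] f) x) atTop (𝓝 M) := by
  have hanti : Antitone fun n => ⨆ x, (T^[n] f) x := antitone_nat_of_succ_le fun n => by
    rw [Function.iterate_succ_apply']
    exact iSup_map_le_of_map_one hT _
  obtain ⟨x⟩ := ‹Nonempty X›
  refine ⟨_, tendsto_atTop_ciInf hanti ⟨-‖f‖, ?_⟩⟩
  rintro _ ⟨n, rfl⟩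
  calc -‖f‖ ≤ -‖T^[n] f‖ := neg_le_neg (norm_iterate_le_of_map_one hT f n)
    _ ≤ (T^[n] f) x := neg_le_of_abs_le ((T^[n] f).norm_coe_le_norm x)
    _ ≤ ⨆ x, (T^[n] f) x := le_iSup_continuousMap _ x

lemma eq_const_of_iSup_iterate_eq [Nonempty X] (hT : T 1 = 1) (hpos : IsEventuallyPositive T)
    {h : C(X, ℝ)} {M : ℝ} (hM : ∀ r, ⨆ x, (T^[r] h) x = M) : h = ContinuousMap.const X M := by
  by_contra hne
  have hle : h ≤ ContinuousMap.const X M := fun x => (le_iSup_continuousMap h x).trans_eq (hM 0)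
  obtain ⟨r, -, hr⟩ := hpos _ (sub_nonneg.2 hle) (sub_ne_zero.2 (Ne.symm hne))
  rw [iterate_map_sub, Function.iterate_fixed (map_const_of_map_one hT M)] at hr
  obtain ⟨x, hx⟩ := (isCompact_range (T^[r] h).continuous).sSup_mem (Set.range_nonempty _)
  exact (sub_pos.1 (hr x)).ne (hx.trans (hM r))

lemma exists_tendsto_subseq_of_equicontinuous {u : ℕ → C(X, ℝ)} {R : ℝ} (hR : ∀ n, ‖u n‖ ≤ R)
    (hu : Equicontinuous fun n => (u n : X → ℝ)) :
    ∃ (h : C(X, ℝ)) (φ : ℕ → ℕ), StrictMono φ ∧ Tendsto (u ∘ φ) atTop (𝓝 h) := by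
  let e := ContinuousMap.isometryEquivBoundedOfCompact X ℝ
  have hcompact : IsCompact (closure (Set.range (e ∘ u))) := by
    refine BoundedContinuousFunction.arzela_ascoli (Metric.closedBall (0 : ℝ) R)
      (isCompact_closedBall _ _) _ ?_ fun x W hW => ?_
    · rintro _ x ⟨n, rfl⟩
      exact mem_closedBall_zero_iff.2 (((u n).norm_coe_le_norm x).trans (hR n))
    · filter_upwards [hu x W hW] with y hy
      rintro ⟨_, n, rfl⟩
      exact hy n
  obtain ⟨h, -, φ, hφ, hlim⟩ := hcompact.tendsto_subseq (x := e ∘ u)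
    fun n => subset_closure (Set.mem_range_self n)
  refine ⟨e.symm h, φ, hφ, ((e.symm.continuous.tendsto h).comp hlim).congr fun n => ?_⟩
  exact e.symm_apply_apply _

lemma tendsto_iterate_const_of_subseq (hT : T 1 = 1) {f : C(X, ℝ)} {c : ℝ} {φ : ℕ → ℕ}
    (hφ : StrictMono φ)
    (hlim : Tendsto (fun n => T^[φ n] f) atTop (𝓝 (ContinuousMap.const X c))) :
    Tendsto (fun n => T^[n] f) atTop (𝓝 (ContinuousMap.const X c)) := by
  rw [tendsto_iff_norm_sub_tendsto_zero] at hlim ⊢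
  have hanti : Antitone fun n => ‖T^[n] f - ContinuousMap.const X c‖ :=
    antitone_nat_of_succ_le fun n => by
      have := norm_map_le_of_map_one hT (T^[n] f - ContinuousMap.const X c)
      rwa [map_sub, map_const_of_map_one hT, ← Function.iterate_succ_apply' T] at this
  exact (tendsto_iff_tendsto_subseq_of_antitone hanti hφ.tendsto_atTop).2 hlim

theorem exists_tendsto_iterate_const [Nonempty X] (hT : T 1 = 1) (hpos : IsEventuallyPositive T)
    {f : C(X, ℝ)} (hf : Equicontinuous fun n => (T^[n] f : X → ℝ)) :
    ∃ c, Tendsto (fun n => T^[n] f) atTop (𝓝 (ContinuousMap.const X c)) := by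
  obtain ⟨h, φ, hφ, hlim⟩ :=
    exists_tendsto_subseq_of_equicontinuous (norm_iterate_le_of_map_one hT f) hf
  obtain ⟨M, hM⟩ := exists_tendsto_iSup_iterate hT f
  have hiSup (r : ℕ) : ⨆ x, (T^[r] h) x = M := by
    have hcont : Continuous fun u => ⨆ x, (T^[r] u) x :=
      continuous_iSup_continuousMap.comp ((continuous_of_map_one hT).iterate r)
    refine tendsto_nhds_unique ((hcont.tendsto h).comp hlim)
      ((hM.comp (tendsto_atTop_mono (fun n => Nat.le_add_left (φ n) r) hφ.tendsto_atTop)).congr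
        fun n => ?_)
    simp only [Function.comp_apply, Function.iterate_add_apply]
  rw [eq_const_of_iSup_iterate_eq hT hpos hiSup] at hlim
  exact ⟨M, tendsto_iterate_const_of_subseq hT hφ hlim⟩

end PositiveOperators

section InvariantMeasures

variable {X : Type*} [TopologicalSpace X] {T : C(X, ℝ) →ₚ[ℝ] C(X, ℝ)}

variable (T) in
/-- The Cesàro mean of the functionals `f ↦ (T^[j] f) x` for `j ≤ n`. There are `n + 1` of them, so
that the mean never has an empty range of summation. -/
noncomputable def cesaroFunctional (x : X) (n : ℕ) : C(X, ℝ) →ₚ[ℝ] ℝ where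
  toFun f := birkhoffAverage ℝ T (fun h => h x) (n + 1) f
  map_add' f h := by
    simp [birkhoffAverage, birkhoffSum, iterate_map_add, Finset.sum_add_distrib, mul_add]
  map_smul' c f := by
    have hiter (j : ℕ) : T^[j] (c • f) = c • T^[j] f :=
      Function.Commute.iterate_left (g := fun h => c • h) (map_smul T c) j f
    simp [birkhoffAverage, birkhoffSum, hiter, ← Finset.mul_sum, mul_left_comm]
  monotone' f h hfh := by
    refine smul_le_smul_of_nonneg_left (Finset.sum_le_sum fun j _ => ?_) (by positivity)
    exact (OrderHomClass.mono T).iterate j hfh x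

lemma cesaroFunctional_one (hT : T 1 = 1) (x : X) (n : ℕ) : cesaroFunctional T x n 1 = 1 :=
  Function.IsFixedPt.birkhoffAverage_eq ℝ hT _ (Nat.cast_ne_zero.2 n.succ_ne_zero)

variable [CompactSpace X]

lemma abs_apply_le_norm_of_map_one {Λ : C(X, ℝ) →ₚ[ℝ] ℝ} (hΛ : Λ 1 = 1) (f : C(X, ℝ)) :
    |Λ f| ≤ ‖f‖ := by
  have hle {h : C(X, ℝ)} (hh : ∀ x, h x ≤ ‖f‖) : Λ h ≤ ‖f‖ := by
    have : Λ h ≤ Λ (‖f‖ • 1) := OrderHomClass.mono Λ fun x => by simpa using hh x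
    simpa only [map_smul, hΛ, smul_eq_mul, mul_one] using this
  refine abs_le'.2 ⟨hle fun x => (le_abs_self _).trans (f.norm_coe_le_norm x), ?_⟩
  rw [← map_neg]
  exact hle fun x => (neg_le_abs _).trans (f.norm_coe_le_norm x)

lemma exists_tendsto_positive_functional {ι : Type*} (F : Ultrafilter ι)
    {Λ : ι → C(X, ℝ) →ₚ[ℝ] ℝ} (hΛ : ∀ i, Λ i 1 = 1) :
    ∃ L : C(X, ℝ) →ₚ[ℝ] ℝ, L 1 = 1 ∧ ∀ f, Tendsto (fun i => Λ i f) F (𝓝 (L f)) := by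
  have hlim (f : C(X, ℝ)) : ∃ a, Tendsto (fun i => Λ i f) F (𝓝 a) := by
    obtain ⟨a, -, ha⟩ := (isCompact_closedBall (0 : ℝ) ‖f‖).ultrafilter_le_nhds'
      (F.map fun i => Λ i f) (eventually_map.2 <| Eventually.of_forall fun i =>
        mem_closedBall_zero_iff.2 (abs_apply_le_norm_of_map_one (hΛ i) f))
    exact ⟨a, ha⟩
  choose L hL using hlim
  refine ⟨{ toFun := L, map_add' := ?_, map_smul' := ?_, monotone' := ?_ }, ?_, hL⟩
  · exact fun f h => tendsto_nhds_unique (hL (f + h)) (by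
      simpa only [map_add] using (hL f).add (hL h))
  · exact fun c f => tendsto_nhds_unique (hL (c • f)) (by
      simpa only [map_smul, RingHom.id_apply] using (hL f).const_smul c)
  · exact fun f h hfh => le_of_tendsto_of_tendsto' (hL f) (hL h) fun i =>
      OrderHomClass.mono (Λ i) hfh
  · exact tendsto_nhds_unique (hL 1) (by simp only [hΛ, tendsto_const_nhds])

lemma tendsto_cesaroFunctional_map_sub (hT : T 1 = 1) (x : X) (f : C(X, ℝ)) :
    Tendsto (fun n => cesaroFunctional T x n (T f) - cesaroFunctional T x n f) atTop (𝓝 0) := by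
  have hbdd : Bornology.IsBounded (Set.range fun n => (T^[n] f) x) :=
    isBounded_iff_forall_norm_le.2 ⟨‖f‖, by
      rintro _ ⟨n, rfl⟩
      exact ((T^[n] f).norm_coe_le_norm x).trans (norm_iterate_le_of_map_one hT f n)⟩
  exact (tendsto_birkhoffAverage_apply_sub_birkhoffAverage ℝ hbdd).comp (tendsto_add_atTop_nat 1)

lemma exists_invariant_positive_functional [Nonempty X] (hT : T 1 = 1) :
    ∃ Λ : C(X, ℝ) →ₚ[ℝ] ℝ, Λ 1 = 1 ∧ ∀ f, Λ (T f) = Λ f := by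
  obtain ⟨x⟩ := ‹Nonempty X›
  obtain ⟨Λ, hΛ, hlim⟩ :=
    exists_tendsto_positive_functional (hyperfilter ℕ) (cesaroFunctional_one hT x)
  refine ⟨Λ, hΛ, fun f => sub_eq_zero.1 ?_⟩
  exact tendsto_nhds_unique ((hlim (T f)).sub (hlim f))
    ((tendsto_cesaroFunctional_map_sub hT x f).mono_left Nat.hyperfilter_le_atTop)

variable [MeasurableSpace X] [BorelSpace X]

lemma integrable_continuousMap (μ : Measure X) [IsFiniteMeasure μ] (f : C(X, ℝ)) :
    Integrable f μ :=
  f.continuous.integrable_of_hasCompactSupport (HasCompactSupport.of_compactSpace f)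

open scoped CompactlySupported in
lemma exists_probabilityMeasure_integral_eq [T2Space X] (Λ : C(X, ℝ) →ₚ[ℝ] ℝ) (hΛ : Λ 1 = 1) :
    ∃ μ : ProbabilityMeasure X, ∀ f : C(X, ℝ), ∫ x, f x ∂(μ : Measure X) = Λ f := by
  let Λ' : C_c(X, ℝ) →ₚ[ℝ] ℝ :=
    { toFun f := Λ f
      map_add' f h := map_add Λ (f : C(X, ℝ)) h
      map_smul' c f := map_smul Λ c (f : C(X, ℝ))
      monotone' f h hfh := OrderHomClass.mono Λ (show (f : C(X, ℝ)) ≤ h from hfh) }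
  have hint (f : C(X, ℝ)) : ∫ x, f x ∂(RealRMK.rieszMeasure Λ') = Λ f :=
    RealRMK.integral_rieszMeasure Λ' (CompactlySupportedContinuousMap.continuousMapEquiv f)
  refine ⟨⟨RealRMK.rieszMeasure Λ', ⟨?_⟩⟩, hint⟩
  rw [← ENNReal.toReal_eq_one_iff]
  simpa [Measure.real, hΛ] using hint 1

theorem exists_isInvariantMeasure [T2Space X] [Nonempty X] (hT : T 1 = 1) :
    ∃ μ : ProbabilityMeasure X, IsInvariantMeasure T μ := by
  obtain ⟨Λ, hΛ, hinv⟩ := exists_invariant_positive_functional hT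
  obtain ⟨μ, hμ⟩ := exists_probabilityMeasure_integral_eq Λ hΛ
  exact ⟨μ, fun f => by rw [hμ, hμ, hinv]⟩

end InvariantMeasures

section FullSupport

variable {X : Type*} [TopologicalSpace X]

lemma exists_continuousMap_support_subset [NormalSpace X] [T1Space X] {U : Set X} (hU : IsOpen U)
    (hne : U.Nonempty) : ∃ f : C(X, ℝ), 0 ≤ f ∧ f ≠ 0 ∧ Function.support f ⊆ U := by
  obtain ⟨x, hx⟩ := hne
  obtain ⟨f, hf0, hf1, hf⟩ := exists_continuous_zero_one_of_isClosed hU.isClosed_compl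
    isClosed_singleton (Set.disjoint_singleton_right.2 (Set.notMem_compl_iff.2 hx))
  refine ⟨f, fun y => (hf y).1, fun h => ?_, Function.support_subset_iff'.2 hf0⟩
  simpa [h] using hf1 rfl

variable [MeasurableSpace X] {T : C(X, ℝ) → C(X, ℝ)} {μ : Measure X}

lemma IsInvariantMeasure.integral_iterate (hμ : IsInvariantMeasure T μ) (f : C(X, ℝ)) (n : ℕ) :
    ∫ x, (T^[n] f) x ∂μ = ∫ x, f x ∂μ := by
  induction n with
  | zero => rfl
  | succ n ih => rw [Function.iterate_succ_apply', hμ, ih]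

variable [CompactSpace X] [BorelSpace X] [IsFiniteMeasure μ] [NeZero μ]

lemma integral_pos_of_forall_pos {f : C(X, ℝ)} (hf : ∀ x, 0 < f x) : 0 < ∫ x, f x ∂μ := by
  rw [integral_pos_iff_support_of_nonneg (fun x => (hf x).le) (integrable_continuousMap μ f),
    Function.support_eq_univ fun x => (hf x).ne']
  exact Measure.measure_univ_pos.2 (NeZero.ne μ)

lemma IsInvariantMeasure.isOpenPosMeasure [T2Space X] (hμ : IsInvariantMeasure T μ)
    (hT : IsEventuallyPositive T) : μ.IsOpenPosMeasure := by
  refine ⟨fun U hU hne hμU => ?_⟩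
  obtain ⟨f, hf, hf0, hfU⟩ := exists_continuousMap_support_subset hU hne
  obtain ⟨r, -, hr⟩ := hT f hf hf0
  have hpos : 0 < ∫ x, f x ∂μ := hμ.integral_iterate f r ▸ integral_pos_of_forall_pos hr
  have hsupp : 0 < μ (Function.support f) :=
    (integral_pos_iff_support_of_nonneg (f := f) hf (integrable_continuousMap μ f)).1 hpos
  exact hsupp.ne' (measure_mono_null hfU hμU)

end FullSupport

section AveragingOperators

variable {ι X : Type*} [Fintype ι] [TopologicalSpace X] {g : ι → C(X, X)} {p : ι → ℝ≥0}

/-- The dual operator `f ↦ ∑ i, p i • f ∘ g i` of the iterated function system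
`(g, p)`, as a positive operator on continuous functions. -/
noncomputable def averagingOperator (g : ι → C(X, X)) (p : ι → ℝ≥0) :
    C(X, ℝ) →ₚ[ℝ] C(X, ℝ) where
  toFun f := ∑ i, p i • f.comp (g i)
  map_add' f h := by simp only [ContinuousMap.add_comp, smul_add, Finset.sum_add_distrib]
  map_smul' c f := by
    simp only [ContinuousMap.smul_comp, RingHom.id_apply, Finset.smul_sum, smul_comm c]
  monotone' f h hfh := Finset.sum_le_sum fun i _ =>
    smul_le_smul_of_nonneg_left (fun x => hfh (g i x)) (p i).2

lemma averagingOperator_apply (f : C(X, ℝ)) (x : X) :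
    averagingOperator g p f x = ∑ i, p i * f (g i x) := by
  change (∑ i, p i • f.comp (g i)) x = _
  simp only [ContinuousMap.sum_apply, ContinuousMap.smul_apply, ContinuousMap.comp_apply,
    NNReal.smul_def, smul_eq_mul]

lemma averagingOperator_one (hp : ∑ i, p i = 1) : averagingOperator g p 1 = 1 := by
  ext x
  simpa [averagingOperator_apply] using congrArg NNReal.toReal hp

lemma averagingOperator_apply_pos {i : ι} (hp : 0 < p i) {f : C(X, ℝ)} (hf : 0 ≤ f) {x : X}
    (hx : 0 < f (g i x)) : 0 < averagingOperator g p f x := by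
  rw [averagingOperator_apply]
  exact Finset.sum_pos' (fun j _ => mul_nonneg (p j).2 (hf _)) ⟨i, Finset.mem_univ i, mul_pos hp hx⟩

lemma iterate_averagingOperator_nonneg {f : C(X, ℝ)} (hf : 0 ≤ f) (n : ℕ) :
    0 ≤ (averagingOperator g p)^[n] f := by
  have h0 : (averagingOperator g p)^[n] 0 = 0 := Function.iterate_fixed (map_zero _) n
  exact h0 ▸ (OrderHomClass.mono (averagingOperator g p)).iterate n hf

lemma iterate_averagingOperator_apply_pos {i : ι} (hp : 0 < p i) {f : C(X, ℝ)} (hf : 0 ≤ f)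
    {n : ℕ} {x : X} (hx : 0 < f ((g i)^[n] x)) : 0 < ((averagingOperator g p)^[n] f) x := by
  induction n generalizing x with
  | zero => exact hx
  | succ n ih =>
    rw [Function.iterate_succ_apply']
    exact averagingOperator_apply_pos hp (iterate_averagingOperator_nonneg hf n) (ih hx)

variable [CompactSpace X] [MeasurableSpace X] [BorelSpace X] {μ : Measure X} [IsFiniteMeasure μ]

lemma integral_averagingOperator (f : C(X, ℝ)) :
    ∫ x, averagingOperator g p f x ∂μ = ∑ i, p i * ∫ x, f (g i x) ∂μ := by
  simp only [averagingOperator_apply]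
  refine (integral_finsetSum _ fun i _ =>
    (integrable_continuousMap μ (f.comp (g i))).const_mul (p i : ℝ)).trans ?_
  simp only [integral_const_mul, ContinuousMap.comp_apply]

lemma integral_averagingOperator_eq_integral_sum_map (f : C(X, ℝ)) :
    ∫ x, averagingOperator g p f x ∂μ = ∫ x, f x ∂(∑ i, p i • μ.map (g i)) := by
  rw [integral_averagingOperator, integral_finsetSum_measure fun i _ =>
    integrable_continuousMap (p i • μ.map (g i)) f]
  refine Finset.sum_congr rfl fun i _ => ?_
  rw [integral_smul_nnreal_measure, integral_map (g i).continuous.aemeasurable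
    f.continuous.aestronglyMeasurable, NNReal.smul_def, smul_eq_mul]

lemma IsInvariantMeasure.sum_map_eq [HasOuterApproxClosed X]
    (hμ : IsInvariantMeasure (averagingOperator g p) μ) :
    ∑ i, p i • μ.map (g i) = μ :=
  ext_of_forall_integral_eq_of_IsFiniteMeasure fun f =>
    (integral_averagingOperator_eq_integral_sum_map f.toContinuousMap).symm.trans (hμ _)

lemma IsInvariantMeasure.measureReal_eq_sum_image [HasOuterApproxClosed X] {g : ι → X ≃ₜ X}
    (hμ : IsInvariantMeasure (averagingOperator (fun i => (g i).symm) p) μ) (s : Set X) :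
    μ.real s = ∑ i, p i * μ.real (g i '' s) := by
  have hsum : ∑ i, p i • μ.map (g i).symm = μ := hμ.sum_map_eq
  have himage (i : ι) : (μ.map (g i).symm).real s = μ.real (g i '' s) := by
    rw [← (g i).preimage_symm]
    exact congrArg ENNReal.toReal ((g i).symm.toMeasurableEquiv.map_apply s)
  calc μ.real s = (∑ i, p i • μ.map (g i).symm).real s := by rw [hsum]
    _ = ∑ i, (p i • μ.map (g i).symm).real s := by
      simp only [Measure.real, Measure.finsetSum_apply, ENNReal.toReal_sum fun i _ =>
        measure_ne_top (p i • μ.map (g i).symm) s]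
    _ = ∑ i, p i * μ.real (g i '' s) := by simp only [measureReal_nnreal_smul_apply, himage]

end AveragingOperators

section Translations

variable {ι G : Type*} [Fintype ι] [AddCommGroup G] [TopologicalSpace G] [ContinuousAdd G]
  [CompactSpace G]

lemma exists_forall_exists_le_add_nsmul_mem {c : G} (hc : DenseRange fun n : ℕ => n • c)
    {U : Set G} (hU : IsOpen U) (hne : U.Nonempty) : ∃ N : ℕ, ∀ x, ∃ m ≤ N, x + m • c ∈ U := by
  have hopen (m : ℕ) : IsOpen ((· + m • c) ⁻¹' U) := hU.preimage (continuous_add_const _)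
  obtain ⟨u, hu⟩ := hne
  have hcover : Set.univ ⊆ ⋃ m : ℕ, (· + m • c) ⁻¹' U := fun x _ =>
    Set.mem_iUnion.2 <| hc.exists_mem_open (hU.preimage (continuous_const_add x))
      ⟨u - x, by rwa [Set.mem_preimage, add_sub_cancel]⟩
  obtain ⟨t, ht⟩ := isCompact_univ.elim_finite_subcover _ hopen hcover
  refine ⟨t.sup id, fun x => ?_⟩
  obtain ⟨m, hm, hx⟩ := Set.mem_iUnion₂.1 (ht (Set.mem_univ x))
  exact ⟨m, t.le_sup (f := id) hm, hx⟩

lemma isEventuallyPositive_averagingOperator {g : ι → C(G, G)} {p : ι → ℝ≥0} {i j : ι} {a b : G}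
    (hi : 0 < p i) (hgi : ⇑(g i) = (· + a)) (hj : 0 < p j) (hgj : ⇑(g j) = (· + b))
    (hab : DenseRange fun n : ℕ => n • (a - b)) :
    IsEventuallyPositive (averagingOperator g p) := by
  intro f hf hf0
  obtain ⟨u, hu⟩ := DFunLike.ne_iff.1 hf0
  have hopen : IsOpen {y | 0 < f y} := isOpen_lt continuous_const f.continuous
  obtain ⟨N, hN⟩ := exists_forall_exists_le_add_nsmul_mem hab hopen ⟨u, (hf u).lt_of_ne' hu⟩
  refine ⟨N + 1, N.succ_pos, fun x => ?_⟩
  obtain ⟨m, hm, hx⟩ := hN (x + (N + 1) • b)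
  obtain ⟨l, hl⟩ : ∃ l, N + 1 = m + l := Nat.exists_eq_add_of_le (Nat.le_succ_of_le hm)
  have hmix : x + l • b + m • a = x + (N + 1) • b + m • (a - b) := by
    rw [hl, add_smul, smul_sub]
    abel
  rw [← hmix] at hx
  have hpos : 0 < ((averagingOperator g p)^[m] f) ((g j)^[l] x) := by
    refine iterate_averagingOperator_apply_pos hi hf ?_
    rw [hgi, hgj, add_right_iterate, add_right_iterate]
    exact hx
  rw [hl, add_comm, Function.iterate_add_apply]
  exact iterate_averagingOperator_apply_pos hj (iterate_averagingOperator_nonneg hf m) hpos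

end Translations

section Atoms

lemma isOfFinAddOrder_of_finite_mapsTo {G : Type*} [AddGroup G] {s : Set G} {a : G}
    (hs : s.Finite) (hne : s.Nonempty) (h : Set.MapsTo (· + a) s s) : IsOfFinAddOrder a := by
  by_contra ha
  obtain ⟨x, hx⟩ := hne
  have horbit (n : ℕ) : x + n • a ∈ s := by
    simpa only [add_right_iterate] using h.iterate n hx
  have hinj : Function.Injective fun n : ℕ => x + n • a :=
    (add_right_injective x).comp (injective_nsmul_iff_not_isOfFinAddOrder.2 ha)
  exact Set.infinite_of_injective_forall_mem hinj horbit hs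

/-- The points of largest mass of a measure. If the measure has an atom, these are its heaviest
atoms. -/
def maximalAtoms {X : Type*} [MeasurableSpace X] (μ : Measure X) : Set X :=
  {x | ∀ y, μ.real {y} ≤ μ.real {x}}

section

variable {X : Type*} [MeasurableSpace X] [MeasurableSingletonClass X] {μ : Measure X}
  [IsFiniteMeasure μ] {x : X}

lemma finite_setOf_le_measureReal_singleton {ε : ℝ} (hε : 0 < ε) :
    {y | ε ≤ μ.real {y}}.Finite := by
  have h := Measure.finite_const_le_meas_of_disjoint_iUnion μ (ENNReal.ofReal_pos.2 hε)
    (fun y : X => measurableSet_singleton y)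
    (fun y z hyz => Set.disjoint_singleton.2 hyz) (measure_ne_top μ _)
  simpa only [Measure.real, ← ENNReal.ofReal_le_iff_le_toReal (measure_ne_top μ _)] using h

lemma finite_maximalAtoms (hx : 0 < μ.real {x}) : (maximalAtoms μ).Finite :=
  (finite_setOf_le_measureReal_singleton hx).subset fun _ hy => hy x

lemma nonempty_maximalAtoms (hx : 0 < μ.real {x}) : (maximalAtoms μ).Nonempty := by
  obtain ⟨z, hz, hmax⟩ :=
    (finite_setOf_le_measureReal_singleton hx).exists_maximalFor
      (fun y => μ.real {y}) _ ⟨x, le_refl (μ.real {x})⟩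
  refine ⟨z, fun y => ?_⟩
  by_contra! hlt
  exact hlt.not_ge (hmax (hz.trans hlt.le) hlt.le)

end

variable {ι X : Type*} [Fintype ι] [TopologicalSpace X] [CompactSpace X] [MeasurableSpace X]
  [BorelSpace X] [HasOuterApproxClosed X] {g : ι → X ≃ₜ X} {p : ι → ℝ≥0} {μ : Measure X}
  [IsFiniteMeasure μ]

lemma mapsTo_maximalAtoms {i : ι} (hp : ∑ i, p i = 1) (hi : 0 < p i)
    (hμ : IsInvariantMeasure (averagingOperator (fun i => (g i).symm) p) μ) :
    Set.MapsTo (g i) (maximalAtoms μ) (maximalAtoms μ) := by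
  intro x hx y
  have hsum : ∑ j, (p j : ℝ) * μ.real {g j x} = ∑ j, (p j : ℝ) * μ.real {x} := by
    rw [← Finset.sum_mul, ← NNReal.coe_sum, hp, NNReal.coe_one, one_mul,
      hμ.measureReal_eq_sum_image {x}]
    simp only [Set.image_singleton]
  have heq := (Finset.sum_eq_sum_iff_of_le fun j _ =>
    mul_le_mul_of_nonneg_left (hx (g j x)) (p j).2).1 hsum i (Finset.mem_univ i)
  exact (hx y).trans_eq (mul_left_cancel₀ (NNReal.coe_pos.2 hi).ne' heq).symm

lemma nullSingletonClass_of_translations {G : Type*} [AddCommGroup G] [TopologicalSpace G]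
    [CompactSpace G] [T1Space G] [MeasurableSpace G] [BorelSpace G] [HasOuterApproxClosed G]
    {g : ι → G ≃ₜ G} {μ : Measure G} [IsFiniteMeasure μ] {i j : ι} {a b : G} (hp : ∑ i, p i = 1)
    (hi : 0 < p i) (hgi : ⇑(g i) = (· + a)) (hj : 0 < p j) (hgj : ⇑(g j) = (· + b))
    (hab : ¬IsOfFinAddOrder (a - b))
    (hμ : IsInvariantMeasure (averagingOperator (fun i => (g i).symm) p) μ) :
    NullSingletonClass μ := by
  refine ⟨fun x => by_contra fun hx => hab ?_⟩
  have hpos : 0 < μ.real {x} := ENNReal.toReal_pos hx (measure_ne_top μ _)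
  have hfin {l : ι} {c : G} (hl : 0 < p l) (hgl : ⇑(g l) = (· + c)) : IsOfFinAddOrder c :=
    isOfFinAddOrder_of_finite_mapsTo (finite_maximalAtoms hpos) (nonempty_maximalAtoms hpos)
      (hgl ▸ mapsTo_maximalAtoms hp hl hμ)
  rw [sub_eq_add_neg]
  exact (hfin hi hgi).add (hfin hj hgj).neg

end Atoms

section VariationBounds

variable {X : Type*} [TopologicalSpace X] [MeasurableSpace X]

/-- The oscillation of `f` on a connected set is at most `ε` plus `C` times the mass of the set.
This is a modulus of continuity in which `μ` replaces the metric; it is tested on all preconnected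
sets, because homeomorphisms permute these. -/
def HasVariationBound (μ : Measure X) (ε C : ℝ) (f : X → ℝ) : Prop :=
  ∀ ⦃A : Set X⦄, IsPreconnected A → ∀ ⦃x⦄, x ∈ A → ∀ ⦃y⦄, y ∈ A →
    dist (f x) (f y) ≤ ε + C * μ.real A

variable {μ : Measure X}

lemma exists_isOpen_isPreconnected_measure_lt [LocallyConnectedSpace X] [μ.OuterRegular]
    [NullSingletonClass μ] (x : X) {η : ENNReal} (hη : 0 < η) :
    ∃ U : Set X, IsOpen U ∧ IsPreconnected U ∧ x ∈ U ∧ μ U < η := by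
  obtain ⟨V, hxV, hV, hμV⟩ :=
    Set.exists_isOpen_lt_of_lt {x} η ((measure_singleton (μ := μ) x).trans_lt hη)
  exact ⟨connectedComponentIn V x, hV.connectedComponentIn, isPreconnected_connectedComponentIn,
    mem_connectedComponentIn (hxV rfl),
    (measure_mono (connectedComponentIn_subset V x)).trans_lt hμV⟩

lemma equicontinuous_of_hasVariationBound {κ : Type*} [LocallyConnectedSpace X] [μ.OuterRegular]
    [NullSingletonClass μ] {u : κ → X → ℝ}
    (hu : ∀ ε > 0, ∃ C, ∀ n, HasVariationBound μ ε C (u n)) : Equicontinuous u := by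
  refine fun x => Metric.equicontinuousAt_iff_right.2 fun ε hε => ?_
  obtain ⟨C, hC⟩ := hu (ε / 2) (half_pos hε)
  obtain ⟨η, hη, hCη⟩ : ∃ η > 0, |C| * η < ε / 2 := exists_pos_mul_lt (half_pos hε) |C|
  obtain ⟨U, hU, hconn, hxU, hμU⟩ :=
    exists_isOpen_isPreconnected_measure_lt (μ := μ) x (ENNReal.ofReal_pos.2 hη)
  filter_upwards [hU.mem_nhds hxU] with y hy n
  have hreal : μ.real U ≤ η := ENNReal.toReal_le_of_le_ofReal hη.le hμU.le
  calc dist (u n x) (u n y) ≤ ε / 2 + C * μ.real U := hC n hconn hxU hy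
    _ ≤ ε / 2 + |C| * η := by gcongr; exact le_abs_self C
    _ < ε := by linarith

lemma HasVariationBound.map_averagingOperator {ι : Type*} [Fintype ι] [CompactSpace X]
    [BorelSpace X] [HasOuterApproxClosed X] [IsFiniteMeasure μ] {g : ι → X ≃ₜ X} {p : ι → ℝ≥0}
    {ε C : ℝ} {f : C(X, ℝ)} (hp : ∑ i, p i = 1)
    (hμ : IsInvariantMeasure (averagingOperator (fun i => (g i).symm) p) μ)
    (hf : HasVariationBound μ ε C f) :
    HasVariationBound μ ε C (averagingOperator (fun i => (g i : C(X, X))) p f) := by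
  intro A hA x hx y hy
  have hp' : ∑ i, (p i : ℝ) = 1 := by exact_mod_cast hp
  have hi (i : ι) : dist (f (g i x)) (f (g i y)) ≤ ε + C * μ.real (g i '' A) :=
    hf (hA.image _ (g i).continuous.continuousOn) (Set.mem_image_of_mem _ hx)
      (Set.mem_image_of_mem _ hy)
  simp only [averagingOperator_apply]
  calc dist (∑ i, p i * f (g i x)) (∑ i, p i * f (g i y))
      ≤ ∑ i, dist (p i * f (g i x)) (p i * f (g i y)) := dist_sum_sum_le _ _ _
    _ = ∑ i, p i * dist (f (g i x)) (f (g i y)) := by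
      simp only [Real.dist_eq, ← mul_sub, abs_mul, NNReal.abs_eq]
    _ ≤ ∑ i, p i * (ε + C * μ.real (g i '' A)) := by gcongr with i; exact hi i
    _ = ε + C * μ.real A := by
      simp only [hμ.measureReal_eq_sum_image A, mul_add, Finset.sum_add_distrib, ← Finset.sum_mul,
        hp', Finset.mul_sum, mul_left_comm C, one_mul]

lemma HasVariationBound.iterate_map_averagingOperator {ι : Type*} [Fintype ι] [CompactSpace X]
    [BorelSpace X] [HasOuterApproxClosed X] [IsFiniteMeasure μ] {g : ι → X ≃ₜ X} {p : ι → ℝ≥0}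
    {ε C : ℝ} {f : C(X, ℝ)} (hp : ∑ i, p i = 1)
    (hμ : IsInvariantMeasure (averagingOperator (fun i => (g i).symm) p) μ)
    (hf : HasVariationBound μ ε C f) (n : ℕ) :
    HasVariationBound μ ε C ((averagingOperator (fun i => (g i : C(X, X))) p)^[n] f) := by
  induction n with
  | zero => exact hf
  | succ n ih =>
    rw [Function.iterate_succ_apply']
    exact ih.map_averagingOperator hp hμ

end VariationBounds

section Balls

variable {X : Type*} [PseudoMetricSpace X] [CompactSpace X] [MeasurableSpace X]

lemma exists_pos_forall_le_measureReal_ball (μ : Measure X) [IsFiniteMeasure μ]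
    [μ.IsOpenPosMeasure] {r : ℝ} (hr : 0 < r) :
    ∃ c > 0, ∀ x, c ≤ μ.real (Metric.ball x r) := by
  obtain ⟨t, -, ht, hcover⟩ := isCompact_univ.finite_cover_balls (X := X) (half_pos hr)
  have hpos (z : X) : 0 < μ.real (Metric.ball z (r / 2)) :=
    ENNReal.toReal_pos (Metric.measure_ball_pos μ z (half_pos hr)).ne' (measure_ne_top μ _)
  have hsmall : ∀ᶠ c in 𝓝[>] (0 : ℝ), ∀ z ∈ t, c ≤ μ.real (Metric.ball z (r / 2)) :=
    (eventually_all_finite ht).2 fun z _ => nhdsWithin_le_nhds (Iic_mem_nhds (hpos z))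
  obtain ⟨c, hc, hc0⟩ := (hsmall.and self_mem_nhdsWithin).exists
  refine ⟨c, hc0, fun x => ?_⟩
  obtain ⟨z, hz, hxz⟩ := Set.mem_iUnion₂.1 (hcover (Set.mem_univ x))
  refine (hc z hz).trans (measureReal_mono (Metric.ball_subset ?_))
  linarith [Metric.mem_ball'.1 hxz]

lemma exists_hasVariationBound {μ : Measure X}
    (hμ : ∀ δ > 0, ∃ c > 0, ∀ A : Set X, IsPreconnected A → ∀ x ∈ A, ∀ y ∈ A, δ ≤ dist x y →
      c ≤ μ.real A) (f : C(X, ℝ)) {ε : ℝ} (hε : 0 < ε) : ∃ C, HasVariationBound μ ε C f := by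
  obtain ⟨δ, hδ, hfδ⟩ := Metric.uniformContinuous_iff.1
    (CompactSpace.uniformContinuous_of_continuous f.continuous) ε hε
  obtain ⟨c, hc, hcA⟩ := hμ δ hδ
  refine ⟨2 * ‖f‖ / c, fun A hA x hx y hy => ?_⟩
  have hosc : 0 ≤ 2 * ‖f‖ / c := by positivity
  rcases lt_or_ge (dist x y) δ with hxy | hxy
  · exact (hfδ hxy).le.trans (le_add_of_nonneg_right (mul_nonneg hosc measureReal_nonneg))
  · calc dist (f x) (f y) ≤ 2 * ‖f‖ := f.dist_le_two_norm x y
      _ = 2 * ‖f‖ / c * c := (div_mul_cancel₀ _ hc.ne').symm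
      _ ≤ 2 * ‖f‖ / c * μ.real A := mul_le_mul_of_nonneg_left (hcA A hA x hx y hy hxy) hosc
      _ ≤ ε + 2 * ‖f‖ / c * μ.real A := le_add_of_nonneg_left hε.le

end Balls

section Circle

lemma ball_midpoint_subset_uIcc {a b δ : ℝ} (h : δ ≤ dist a b) :
    Metric.ball ((a + b) / 2) (δ / 2) ⊆ Set.uIcc a b := by
  wlog hab : a ≤ b generalizing a b
  · rw [Set.uIcc_comm, add_comm]
    exact this (dist_comm a b ▸ h) (le_of_not_ge hab)
  rw [dist_comm, Real.dist_eq, abs_of_nonneg (sub_nonneg.2 hab)] at h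
  rw [Set.uIcc_of_le hab, Real.Icc_eq_closedBall]
  exact Metric.ball_subset_closedBall.trans (Metric.closedBall_subset_closedBall (by linarith))

variable {T : ℝ}

instance : LocallyConnectedSpace (AddCircle T) :=
  (QuotientAddGroup.isQuotientMap_mk (N := AddSubgroup.zmultiples T)).locallyConnectedSpace

lemma ball_coe_subset_image_coe_ball (a r : ℝ) :
    Metric.ball (a : AddCircle T) r ⊆ (↑) '' Metric.ball a r := by
  intro z hz
  obtain ⟨s, hs, hsr⟩ := QuotientAddGroup.norm_lt_iff.1 (mem_ball_iff_norm.1 hz)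
  exact ⟨a + s, by simpa using hsr, by rw [AddCircle.coe_add, hs, add_sub_cancel]⟩

variable [Fact (0 < T)]

lemma exists_image_uIcc_subset {A : Set (AddCircle T)} (hA : IsPreconnected A) {x y : AddCircle T}
    (hx : x ∈ A) (hy : y ∈ A) :
    ∃ a b : ℝ, (a : AddCircle T) = x ∧ (b : AddCircle T) = y ∧ (↑) '' Set.uIcc a b ⊆ A := by
  rcases eq_or_ne A Set.univ with rfl | hne
  · obtain ⟨a, rfl⟩ := QuotientAddGroup.mk_surjective x
    obtain ⟨b, rfl⟩ := QuotientAddGroup.mk_surjective y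
    exact ⟨a, b, rfl, rfl, Set.subset_univ _⟩
  obtain ⟨u, hu⟩ := (Set.ne_univ_iff_exists_notMem A).1 hne
  obtain ⟨u, rfl⟩ := QuotientAddGroup.mk_surjective u
  let e := AddCircle.openPartialHomeomorphCoe T u
  have hAe : A ⊆ e.target := fun z hz hzu => hu (hzu ▸ hz)
  have hord : (e.symm '' A).OrdConnected :=
    (hA.image e.symm (e.continuousOn_symm.mono hAe)).ordConnected
  refine ⟨e.symm x, e.symm y, e.right_inv (hAe hx), e.right_inv (hAe hy), ?_⟩
  rintro _ ⟨t, ht, rfl⟩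
  obtain ⟨z, hz, rfl⟩ :=
    hord.uIcc_subset (Set.mem_image_of_mem _ hx) (Set.mem_image_of_mem _ hy) ht
  have hcoe : ((e.symm z : ℝ) : AddCircle T) = z := e.right_inv (hAe hz)
  rwa [hcoe]

lemma exists_ball_subset_of_isPreconnected {A : Set (AddCircle T)} (hA : IsPreconnected A)
    {x y : AddCircle T} (hx : x ∈ A) (hy : y ∈ A) : ∃ z, Metric.ball z (dist x y / 2) ⊆ A := by
  obtain ⟨a, b, rfl, rfl, hab⟩ := exists_image_uIcc_subset hA hx hy
  have hdist : dist (a : AddCircle T) b ≤ dist a b := by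
    rw [dist_eq_norm, dist_eq_norm, ← AddCircle.coe_sub]
    exact QuotientAddGroup.norm_mk_le_norm
  exact ⟨_, (ball_coe_subset_image_coe_ball _ _).trans
    ((Set.image_mono (ball_midpoint_subset_uIcc hdist)).trans hab)⟩

lemma exists_pos_forall_le_measureReal_of_isPreconnected (μ : Measure (AddCircle T))
    [IsFiniteMeasure μ] [μ.IsOpenPosMeasure] {δ : ℝ} (hδ : 0 < δ) :
    ∃ c > 0, ∀ A : Set (AddCircle T), IsPreconnected A → ∀ x ∈ A, ∀ y ∈ A, δ ≤ dist x y →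
      c ≤ μ.real A := by
  obtain ⟨c, hc, hball⟩ := exists_pos_forall_le_measureReal_ball μ (half_pos hδ)
  refine ⟨c, hc, fun A hA x hx y hy hxy => ?_⟩
  obtain ⟨z, hz⟩ := exists_ball_subset_of_isPreconnected hA hx hy
  exact (hball z).trans
    (measureReal_mono ((Metric.ball_subset_ball (by linarith)).trans hz))

variable {ι : Type*} [Fintype ι] {g : ι → AddCircle T ≃ₜ AddCircle T} {p : ι → ℝ≥0}

lemma equicontinuous_iterate_averagingOperator {μ : Measure (AddCircle T)} [IsFiniteMeasure μ]
    [μ.IsOpenPosMeasure] [NullSingletonClass μ] (hp : ∑ i, p i = 1)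
    (hμ : IsInvariantMeasure (averagingOperator (fun i => (g i).symm) p) μ)
    (f : C(AddCircle T, ℝ)) :
    Equicontinuous fun n =>
      ((averagingOperator (fun i => (g i : C(AddCircle T, AddCircle T))) p)^[n] f :
        AddCircle T → ℝ) := by
  refine equicontinuous_of_hasVariationBound (μ := μ) fun ε hε => ?_
  obtain ⟨C, hC⟩ := exists_hasVariationBound
    (fun δ hδ => exists_pos_forall_le_measureReal_of_isPreconnected μ hδ) f hε
  exact ⟨C, hC.iterate_map_averagingOperator hp hμ⟩

lemma denseRange_nsmul_of_not_isOfFinAddOrder {c : AddCircle T} (hc : ¬IsOfFinAddOrder c) :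
    DenseRange fun n : ℕ => n • c :=
  denseRange_zsmul_iff_nsmul.1 (AddCircle.denseRange_zsmul_iff.2 (addOrderOf_eq_zero hc))

variable {i j : ι} {a b : AddCircle T}

lemma exists_isInvariantMeasure_symm_of_rotations (hp : ∑ i, p i = 1)
    (hi : 0 < p i) (hgi : ⇑(g i) = (· + a)) (hj : 0 < p j) (hgj : ⇑(g j) = (· + b))
    (hab : ¬IsOfFinAddOrder (a - b)) :
    ∃ μ : ProbabilityMeasure (AddCircle T),
      IsInvariantMeasure (averagingOperator (fun i => (g i).symm) p) (μ : Measure (AddCircle T)) ∧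
      (μ : Measure (AddCircle T)).IsOpenPosMeasure ∧
      NullSingletonClass (μ : Measure (AddCircle T)) := by
  have hsymm {l : ι} {c : AddCircle T} (hgl : ⇑(g l) = (· + c)) :
      ⇑((g l).symm : C(AddCircle T, AddCircle T)) = (· + -c) := by
    ext x
    exact (g l).injective (by simp [hgl])
  have hdense : DenseRange fun n : ℕ => n • (-a - -b) :=
    denseRange_nsmul_of_not_isOfFinAddOrder (by
      rwa [neg_sub_neg, ← neg_sub a b, isOfFinAddOrder_neg_iff])
  obtain ⟨μ, hμ⟩ := exists_isInvariantMeasure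
    (averagingOperator_one (g := fun i => ((g i).symm : C(AddCircle T, AddCircle T))) hp)
  exact ⟨μ, hμ, hμ.isOpenPosMeasure (isEventuallyPositive_averagingOperator hi (hsymm hgi) hj
    (hsymm hgj) hdense), nullSingletonClass_of_translations hp hi hgi hj hgj hab hμ⟩

theorem exists_tendsto_iterate_averagingOperator_const (hp : ∑ i, p i = 1)
    (hi : 0 < p i) (hgi : ⇑(g i) = (· + a)) (hj : 0 < p j) (hgj : ⇑(g j) = (· + b))
    (hab : ¬IsOfFinAddOrder (a - b)) (f : C(AddCircle T, ℝ)) :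
    ∃ c, Tendsto
      (fun n => (averagingOperator (fun i => (g i : C(AddCircle T, AddCircle T))) p)^[n] f)
      atTop (𝓝 (ContinuousMap.const _ c)) := by
  obtain ⟨μ, hμ, _, _⟩ :=
    exists_isInvariantMeasure_symm_of_rotations hp hi hgi hj hgj hab
  exact exists_tendsto_iterate_const (averagingOperator_one hp)
    (isEventuallyPositive_averagingOperator hi hgi hj hgj
      (denseRange_nsmul_of_not_isOfFinAddOrder hab))
    (equicontinuous_iterate_averagingOperator hp hμ f)

end Circle

section Stability

section

variable {X : Type*} [TopologicalSpace X] [CompactSpace X] [MeasurableSpace X] [BorelSpace X]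
  {ν : Measure X} [IsProbabilityMeasure ν] {c : ℝ}

lemma tendsto_integral_of_tendsto_const {u : ℕ → C(X, ℝ)}
    (hu : Tendsto u atTop (𝓝 (ContinuousMap.const X c))) :
    Tendsto (fun n => ∫ x, u n x ∂ν) atTop (𝓝 c) := by
  refine tendsto_iff_dist_tendsto_zero.2
    (squeeze_zero (fun n => dist_nonneg) (fun n => ?_) (tendsto_iff_dist_tendsto_zero.1 hu))
  have hc : ∫ x, ContinuousMap.const X c x ∂ν = c := by simp
  rw [dist_eq_norm, dist_eq_norm]
  calc ‖∫ x, u n x ∂ν - c‖ = ‖∫ x, (u n - ContinuousMap.const X c) x ∂ν‖ := by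
        rw [← hc, ← integral_sub (integrable_continuousMap ν _) (integrable_continuousMap ν _)]
        simp only [hc, ContinuousMap.sub_apply]
    _ ≤ ‖u n - ContinuousMap.const X c‖ * ν.real Set.univ :=
      norm_integral_le_of_norm_le_const (ae_of_all _ (ContinuousMap.norm_coe_le_norm _))
    _ = ‖u n - ContinuousMap.const X c‖ := by rw [probReal_univ, mul_one]

lemma IsInvariantMeasure.integral_eq_of_tendsto_const {T : C(X, ℝ) → C(X, ℝ)} {f : C(X, ℝ)}
    (hν : IsInvariantMeasure T ν)
    (h : Tendsto (fun n => T^[n] f) atTop (𝓝 (ContinuousMap.const X c))) : ∫ x, f x ∂ν = c := by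
  have hlim := tendsto_integral_of_tendsto_const (ν := ν) h
  simp only [hν.integral_iterate] at hlim
  exact tendsto_const_nhds_iff.1 hlim

end

variable {k : ℕ} {g : Fin k → UnitAddCircle ≃ₜ UnitAddCircle} {p : Fin k → ℝ≥0}

lemma dualOperator_eq_averagingOperator :
    dualOperator g p = averagingOperator (fun i => (g i : C(UnitAddCircle, UnitAddCircle))) p := by
  ext f x
  simp only [averagingOperator_apply]
  rfl

lemma integral_markovOperator (ν : FiniteMeasure UnitAddCircle) (f : C(UnitAddCircle, ℝ)) :
    ∫ x, f x ∂(markovOperator g p ν : Measure UnitAddCircle) = ∫ x, dualOperator g p f x ∂ν := by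
  rw [dualOperator_eq_averagingOperator, integral_averagingOperator_eq_integral_sum_map]
  simp [markovOperator, FiniteMeasure.toMeasure_sum, FiniteMeasure.toMeasure_smul]

lemma integral_iterate_markovOperator (ν : FiniteMeasure UnitAddCircle)
    (f : C(UnitAddCircle, ℝ)) (n : ℕ) :
    ∫ x, f x ∂((markovOperator g p)^[n] ν : Measure UnitAddCircle) =
      ∫ x, ((dualOperator g p)^[n] f) x ∂ν := by
  induction n generalizing f with
  | zero => rfl
  | succ n ih => rw [Function.iterate_succ_apply', integral_markovOperator, ih]; rfl

lemma markovOperator_eq_self_iff {ν : FiniteMeasure UnitAddCircle} :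
    markovOperator g p ν = ν ↔
      IsInvariantMeasure (dualOperator g p) (ν : Measure UnitAddCircle) := by
  refine ⟨fun h f => by rw [← integral_markovOperator, h], fun h => ?_⟩
  exact FiniteMeasure.ext_of_forall_integral_eq fun f =>
    (integral_markovOperator ν f.toContinuousMap).trans (h _)

theorem isAsymptoticallyStable_of_tendsto_const (hp : ∑ i, p i = 1)
    (h : ∀ f, ∃ c, Tendsto (fun n => (dualOperator g p)^[n] f) atTop
      (𝓝 (ContinuousMap.const UnitAddCircle c))) :
    IsAsymptoticallyStable (markovOperator g p) := by
  obtain ⟨μ, hμ⟩ := exists_isInvariantMeasure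
    (averagingOperator_one (g := fun i => (g i : C(UnitAddCircle, UnitAddCircle))) hp)
  rw [← dualOperator_eq_averagingOperator] at hμ
  choose c hc using h
  have hint {ν : ProbabilityMeasure UnitAddCircle}
      (hν : IsInvariantMeasure (dualOperator g p) (ν : Measure UnitAddCircle))
      (f : C(UnitAddCircle, ℝ)) : ∫ x, f x ∂(ν : Measure UnitAddCircle) = c f :=
    hν.integral_eq_of_tendsto_const (hc f)
  refine ⟨μ, markovOperator_eq_self_iff.2 hμ, fun ν hν => ?_, fun f ν => ?_⟩
  · have hνμ : ν.toFiniteMeasure = μ.toFiniteMeasure :=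
      FiniteMeasure.ext_of_forall_integral_eq fun f =>
        (hint (markovOperator_eq_self_iff.1 hν) f.toContinuousMap).trans (hint hμ _).symm
    exact ProbabilityMeasure.toMeasure_injective (congrArg FiniteMeasure.toMeasure hνμ)
  · simp only [integral_iterate_markovOperator, hint hμ]
    exact tendsto_integral_of_tendsto_const (ν := (ν : Measure UnitAddCircle)) (hc f)

end Stability

theorem mainTheorem8_general {k : ℕ} (g : Fin k → (UnitAddCircle ≃ₜ UnitAddCircle))
    (α β : ℝ) (hαβ : Irrational (α - β)) (p : Fin k → ℝ≥0)
    (hα : ∃ i, 0 < p i ∧ g i = circleRotation α) (hβ : ∃ j, 0 < p j ∧ g j = circleRotation β)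
    (hp_sum : ∑ i, p i = 1) :
    (∀ f : C(UnitAddCircle, ℝ), (∀ x, 0 ≤ f x) → (∃ x, f x ≠ 0) →
      ∃ r : ℕ, 1 ≤ r ∧ ∀ x, 0 < ((dualOperator g p)^[r] f) x) ∧
    IsAsymptoticallyStable (markovOperator g p) := by
  obtain ⟨i, hi, hgi⟩ := hα
  obtain ⟨j, hj, hgj⟩ := hβ
  replace hgi : ⇑(g i) = (· + (α : UnitAddCircle)) := congrArg _ hgi
  replace hgj : ⇑(g j) = (· + (β : UnitAddCircle)) := congrArg _ hgj
  have hab : ¬IsOfFinAddOrder ((α : UnitAddCircle) - (β : UnitAddCircle)) := by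
    rwa [← AddCircle.coe_sub, AddCircle.isOfFinAddOrder_iff_exists_rat_eq_div, div_one]
  refine ⟨fun f hf ⟨x, hx⟩ => ?_, isAsymptoticallyStable_of_tendsto_const hp_sum fun f => ?_⟩
  · rw [dualOperator_eq_averagingOperator]
    exact isEventuallyPositive_averagingOperator hi hgi hj hgj
      (denseRange_nsmul_of_not_isOfFinAddOrder hab) f hf fun h => hx (h ▸ rfl)
  · rw [dualOperator_eq_averagingOperator]
    exact exists_tendsto_iterate_averagingOperator_const hp_sum hi hgi hj hgj hab f

theorem mainTheorem8 {k : ℕ} (g : Fin k → (UnitAddCircle ≃ₜ UnitAddCircle))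
    (hg : ∀ i, IsOrientationPreserving (g i))
    (α β : ℝ) (hαβ : Irrational (α - β))
    (hα : ∃ i, g i = circleRotation α) (hβ : ∃ j, g j = circleRotation β)
    (p : Fin k → ℝ≥0) (hp_pos : ∀ i, 0 < p i) (hp_sum : ∑ i, p i = 1) :
    (∀ f : C(UnitAddCircle, ℝ), (∀ x, 0 ≤ f x) → (∃ x, f x ≠ 0) →
      ∃ r : ℕ, 1 ≤ r ∧ ∀ x, 0 < ((dualOperator g p)^[r] f) x) ∧
    IsAsymptoticallyStable (markovOperator g p) :=
  mainTheorem8_general g α β hαβ p (hα.imp fun i h => ⟨hp_pos i, h⟩)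
    (hβ.imp fun j h => ⟨hp_pos j, h⟩) hp_sum
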